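/- **Theorem (Correctness of BSM for the insertion case).** Let $G=(V,E)$ be a finite, simple, connected, undirected graph, let $u\neq v$ be two non-adjacent nodes of $G$, and let $G'=(V,E\cup\{e\})$ be obtained by inserting the edge $e=(u,v)$. Let $\Gamma$ and $\Gamma'$ be the sets of all spanning trees of $G$ and of $G'$, and let $\Gamma'_e\subseteq\Gamma'$ be the set of spanning trees of $G'$ that contain $e$. Let $R(e)$ be the effective resistance between $u$ and $v$ in $G'$ (with unit edge resistances): $R(e)=\varphi(u)-\varphi(v)$ for any $\varphi:V\to\mathbb{R}$ with $L'\varphi=\mathbf 1_u-\mathbf 1_v$, where $L'=D'-A'$ is the Laplacian of $G'$. For a nonempty finite set $S$ let $U(S)$ denote the uniform distribution on $S$. Then $\Gamma$, $\Gamma'$ and $\Gamma'_e$ are nonempty, and for every real-valued function $f$ on trees on the node set $V$, $$\mathbb{E}_{\tau\sim U(\Gamma')}[f(\tau)]=(1-R(e))\,\mathbb{E}_{\tau\sim U(\Gamma)}[f(\tau)]+R(e)\,\mathbb{E}_{\tau\sim U(\Gamma'_e)}[f(\tau)].$$ In particular this holds, for every root $r\in V$ and every choice of simple paths $\mathcal{P}_w$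 in $G'$ from $w$ to $r$ ($w\neq r$), for the function $$f(\tau)=\sum_{w\neq r}d(w)\Bigl(\sum_{F\in\mathbb{F}^{\mathcal{P}_w}(\tau)}\mathrm{vol}(T_1(F))-\sum_{F\in\mathbb{F}^{\mathcal{P}_w'}(\tau)}\mathrm{vol}(T_1(F))\Bigr).$$ Here $d$ is the degree in $G'$; $\mathbb{F}^{\mathcal{P}_w}(\tau)$ (respectively $\mathbb{F}^{\mathcal{P}_w'}(\tau)$) is the set of forests obtained from $\tau$ by deleting one edge that is traversed both by $\mathcal{P}_w$ and by the path of $\tau$ from $w$ to $r$, in the same direction (respectively in opposite directions); $T_1(F)$ is the node set of the tree of $F$ that contains $r$; and $\mathrm{vol}(T_1)=\sum_{x\in T_1}d(x)$. -/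

import Mathlib

open scoped BigOperators

noncomputable section

namespace BSM

variable {V : Type*} [Fintype V]

open Classical in
/-- The set of all spanning trees of `G`; a spanning tree is a tree on the whole node set `V`
all of whose edges are edges of `G`. -/
def spanningTrees (G : SimpleGraph V) : Finset (SimpleGraph V) :=
  {T | T ≤ G ∧ T.IsTree}

open Classical in
/-- The set of all spanning trees of `G` that contain the edge `(u, v)`. -/
def spanningTreesWith (G : SimpleGraph V) (u v : V) : Finset (SimpleGraph V) :=
  {T ∈ spanningTrees G | T.Adj u v}

/-- The graph obtained from `G` by inserting the edge `(u, v)`. -/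
def insertEdge (G : SimpleGraph V) (u v : V) : SimpleGraph V :=
  G ⊔ SimpleGraph.edge u v

open Classical in
/-- `φ` is a potential that sends a unit electric current from `u` to `v` through `G`, every edge
of which is a unit resistor: `L φ = 1_u - 1_v`, where `L = D - A` is the Laplacian of `G`. -/
def IsUnitCurrentPotential (G : SimpleGraph V) (u v : V) (φ : V → ℝ) : Prop :=
  (G.lapMatrix ℝ).mulVec φ = Pi.single u 1 - Pi.single v 1

open Classical in
/-- The effective resistance between `u` and `v` in `G`: the potential difference between `u` and
`v` when a unit current is sent from `u` to `v`. On a connected graph such a potential exists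
(`exists_isUnitCurrentPotential`), and the value does not depend on which one is chosen
(`effectiveResistance_eq`). -/
def effectiveResistance (G : SimpleGraph V) (u v : V) : ℝ :=
  if h : ∃ φ : V → ℝ, IsUnitCurrentPotential G u v φ then h.choose u - h.choose v else 0

open Classical in
theorem effectiveResistance_eq {G : SimpleGraph V} (hG : G.Connected) {u v : V} {φ : V → ℝ}
    (hφ : IsUnitCurrentPotential G u v φ) : effectiveResistance G u v = φ u - φ v := by
  have h : ∃ φ : V → ℝ, IsUnitCurrentPotential G u v φ := ⟨φ, hφ⟩
  have hc := h.choose_spec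
  rw [effectiveResistance, dif_pos h]
  have h0 : (G.lapMatrix ℝ).mulVec (h.choose - φ) = 0 := by
    unfold IsUnitCurrentPotential at hc hφ
    rw [Matrix.mulVec_sub]
    exact sub_eq_zero.mpr (hc.trans hφ.symm)
  have h1 := (G.lapMatrix_mulVec_eq_zero_iff_forall_reachable).mp h0 u v (hG u v)
  simp only [Pi.sub_apply] at h1
  linarith

open Classical in
theorem exists_isUnitCurrentPotential {G : SimpleGraph V} (hG : G.Connected) (u v : V) :
    ∃ φ : V → ℝ, IsUnitCurrentPotential G u v φ := by
  have : Nonempty V := ⟨u⟩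
  -- `L + J`, with `J` the all-ones matrix, is injective, hence surjective
  let M : (V → ℝ) →ₗ[ℝ] (V → ℝ) :=
    (Matrix.toLin' (G.lapMatrix ℝ + Matrix.of fun _ _ => (1 : ℝ)))
  have hM : ∀ x i, M x i = (G.lapMatrix ℝ).mulVec x i + ∑ j, x j := by
    intro x i
    simp [M, Matrix.mulVec, dotProduct]
  have hsum : ∀ x : V → ℝ, ∑ i, (G.lapMatrix ℝ).mulVec x i = 0 := by
    intro x
    have h1 : (1 : V → ℝ) ⬝ᵥ (G.lapMatrix ℝ).mulVec x = 0 := by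
      rw [Matrix.dotProduct_mulVec, ← Matrix.mulVec_transpose, (G.isSymm_lapMatrix (R := ℝ)).eq]
      have : (G.lapMatrix ℝ).mulVec (1 : V → ℝ) = 0 := G.lapMatrix_mulVec_const_eq_zero
      rw [this, zero_dotProduct]
    simpa [dotProduct] using h1
  have key : ∀ x : V → ℝ, ∑ i, M x i = Fintype.card V * ∑ j, x j := by
    intro x
    simp only [hM, Finset.sum_add_distrib, hsum]
    simp
  have hcard : (Fintype.card V : ℝ) ≠ 0 := by exact_mod_cast Fintype.card_ne_zero
  have hinj : Function.Injective M := by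
    rw [← LinearMap.ker_eq_bot, LinearMap.ker_eq_bot']
    intro x hx
    have hs : ∑ j, x j = 0 := by
      have := key x
      rw [hx] at this
      simpa [hcard] using this.symm
    have h0 : (G.lapMatrix ℝ).mulVec x = 0 := by
      funext i
      have := hM x i
      rw [hx, hs] at this
      simpa using this.symm
    have hc := (G.lapMatrix_mulVec_eq_zero_iff_forall_reachable).mp h0
    funext i
    have : ∑ j, x j = Fintype.card V * x i := by
      rw [Finset.sum_congr rfl fun j _ => hc j i (hG j i)]
      simp
    rw [hs] at this
    simpa [hcard] using this.symm
  obtain ⟨φ, hφ⟩ := LinearMap.surjective_of_injective hinj (Pi.single u 1 - Pi.single v 1)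
  refine ⟨φ, ?_⟩
  have hs : ∑ j, φ j = 0 := by
    have := key φ
    rw [hφ] at this
    simpa [hcard] using this.symm
  unfold IsUnitCurrentPotential
  funext i
  have := hM φ i
  rw [hφ, hs, add_zero] at this
  exact this.symm

/-- `T` has a simple path from `u` to `r` that traverses the edge `(i, j)` from `i` to `j`.
(If `T` is a tree, the path is the unique one.) -/
def TreePathTraverses (T : SimpleGraph V) (u r i j : V) : Prop :=
  ∃ q : T.Walk u r, q.IsPath ∧ (i, j) ∈ q.darts.map (·.toProd)

open Classical in
/-- Forward path mapping: the 2-forests obtained from `T` by deleting an edge that the path `p`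
and the path of `T` from `u` to `r` traverse in the same direction. -/
def forwardForests {G : SimpleGraph V} {u r : V} (p : G.Path u r) (T : SimpleGraph V) :
    Finset (SimpleGraph V) :=
  {F | ∃ i j, (i, j) ∈ p.1.darts.map (·.toProd) ∧ TreePathTraverses T u r i j ∧
    F = T.deleteEdges {s(i, j)}}

open Classical in
/-- Reverse path mapping: the 2-forests obtained from `T` by deleting an edge that the path `p`
and the path of `T` from `u` to `r` traverse in opposite directions. -/
def reverseForests {G : SimpleGraph V} {u r : V} (p : G.Path u r) (T : SimpleGraph V) :
    Finset (SimpleGraph V) :=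
  {F | ∃ i j, (i, j) ∈ p.1.darts.map (·.toProd) ∧ TreePathTraverses T u r j i ∧
    F = T.deleteEdges {s(i, j)}}

open Classical in
/-- The volume `∑ d(w)`, with the degrees taken in `G`, of the tree of the forest `F` that
contains `r`. -/
def rootVolume (G F : SimpleGraph V) (r : V) : ℝ :=
  ∑ w with F.Reachable r w, (G.degree w : ℝ)

open Classical in
/-- The quantity `f(T)` computed on a tree `T`, for the graph `G`, the root `r` and the fixed
simple paths `P w` from the nodes `w` to `r` (the path from `r` to itself is not used). -/
def treeValue (G : SimpleGraph V) (r : V) (P : ∀ w, G.Path w r) (T : SimpleGraph V) : ℝ :=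
  ∑ w with w ≠ r, (G.degree w : ℝ) *
    (∑ F ∈ forwardForests (P w) T, rootVolume G F r -
      ∑ F ∈ reverseForests (P w) T, rootVolume G F r)

/-- The expectation of `f` under the uniform distribution on the nonempty finite set `S`, in which
each element of `S` has probability `1 / |S|`. -/
def uniformExpectation {α : Type*} (S : Finset α) (f : α → ℝ) : ℝ :=
  ∑ τ ∈ S, (1 / (S.card : ℝ)) * f τ

end BSM

end

/-! A spanning tree of `insertEdge G u v` avoiding the new edge is a spanning tree of `G`, so the
uniform law on all trees is a mixture whose weight on trees containing the edge is their proportion.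
It remains to show that this proportion is the effective resistance. For this a potential is written
down explicitly. Up to the factor 1/N, with N the number of spanning trees, it is `forestCount`.
Exchanging forests for trees (`forestCount_sub`) turns its drop across an edge into the net number
of trees whose path from `u` to `v` crosses that edge. Each tree carries one unit from `u` to `v`,
which gives the Laplacian equation (`lapMatrix_mulVec_forestCount`). At `v` the count is 0; at `u`
it is the number of trees containing the edge. -/

namespace BSM

/-- `F` is a spanning forest with exactly two trees, one containing `a` and the other `b`. -/
structure IsSeparatingForest {V : Type*} (F : SimpleGraph V) (a b : V) : Prop where
  isAcyclic : F.IsAcyclic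
  not_reachable : ¬ F.Reachable a b
  cover : ∀ z, F.Reachable z a ∨ F.Reachable z b

variable {V : Type*} {F T H : SimpleGraph V} {a b u v x y : V}

/-! ### Exchange between trees and two-component forests -/

theorem IsSeparatingForest.isTree_sup_edge (h : IsSeparatingForest F a b) :
    (F ⊔ SimpleGraph.edge a b).IsTree := by
  have hab : a ≠ b := fun hab => h.not_reachable (hab ▸ SimpleGraph.Reachable.refl a)
  have hadj : (F ⊔ SimpleGraph.edge a b).Reachable a b :=
    SimpleGraph.Adj.reachable (by simp [SimpleGraph.edge_adj, hab])
  have hto : ∀ z, (F ⊔ SimpleGraph.edge a b).Reachable z a := fun z =>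
    (h.cover z).elim (fun hz => hz.mono le_sup_left)
      fun hz => (hz.mono le_sup_left).trans hadj.symm
  have : Nonempty V := ⟨a⟩
  exact ⟨⟨fun z w => (hto z).trans (hto w).symm⟩,
    h.isAcyclic.sup_edge_of_not_reachable h.not_reachable⟩

theorem IsSeparatingForest.deleteEdges_sup_edge (h : IsSeparatingForest F a b) :
    (F ⊔ SimpleGraph.edge a b).deleteEdges {s(a, b)} = F := by
  have hab : ¬ F.Adj a b := fun hab => h.not_reachable hab.reachable
  ext c d
  simp only [SimpleGraph.deleteEdges_adj, SimpleGraph.sup_adj, SimpleGraph.edge_adj,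
    Set.mem_singleton_iff, Sym2.eq_iff]
  constructor
  · rintro ⟨h1 | h1, h2⟩
    · exact h1
    · exact absurd h1.1 (by tauto)
  · intro h1
    refine ⟨Or.inl h1, ?_⟩
    rintro (⟨rfl, rfl⟩ | ⟨rfl, rfl⟩)
    · exact hab h1
    · exact hab h1.symm

theorem deleteEdges_sup_edge_of_adj (h : T.Adj a b) :
    T.deleteEdges {s(a, b)} ⊔ SimpleGraph.edge a b = T := by
  ext c d
  simp only [SimpleGraph.deleteEdges_adj, SimpleGraph.sup_adj, SimpleGraph.edge_adj,
    Set.mem_singleton_iff, Sym2.eq_iff]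
  constructor
  · rintro (h1 | ⟨⟨rfl, rfl⟩ | ⟨rfl, rfl⟩, -⟩)
    · exact h1.1
    · exact h
    · exact h.symm
  · intro h1
    have := h1.ne
    tauto

theorem isBridge_of_isTree (hT : T.IsTree) (h : T.Adj a b) :
    ¬ (T.deleteEdges {s(a, b)}).Reachable a b :=
  SimpleGraph.isBridge_iff.mp (SimpleGraph.isAcyclic_iff_forall_adj_isBridge.mp hT.isAcyclic h)

/-- A simple path never returns to its start, so its tail avoids the first edge. -/
theorem reachable_deleteEdges_of_isPath_cons {h : T.Adj x y} {q : T.Walk y v}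
    (hp : (SimpleGraph.Walk.cons h q).IsPath) : (T.deleteEdges {s(x, y)}).Reachable y v := by
  rw [SimpleGraph.Walk.cons_isPath_iff] at hp
  refine ⟨q.transfer _ fun e he => ?_⟩
  rw [SimpleGraph.edgeSet_deleteEdges]
  refine ⟨q.edges_subset_edgeSet he, ?_⟩
  rintro rfl
  exact hp.2 (q.fst_mem_support_of_mem_edges he)

/-- In a tree, a node `v ≠ x` lies beyond exactly one neighbour of `x`. -/
theorem existsUnique_adj_reachable_deleteEdges (hT : T.IsTree) (hxv : x ≠ v) :
    ∃! y, T.Adj x y ∧ (T.deleteEdges {s(x, y)}).Reachable y v := by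
  obtain ⟨p, hp, huniq⟩ := hT.existsUnique_path x v
  cases p with
  | nil => exact absurd rfl hxv
  | @cons _ y _ h q =>
    refine ⟨y, ⟨h, reachable_deleteEdges_of_isPath_cons hp⟩, ?_⟩
    rintro z ⟨hz, hr⟩
    obtain ⟨w, hw⟩ := hr.exists_isPath
    -- A visit to `x` would join `z` to `x` without the bridge between them.
    have hx : x ∉ w.support := fun hx => by
      classical exact isBridge_of_isTree hT hz ⟨(w.takeUntil x hx).reverse⟩
    have := huniq (SimpleGraph.Walk.cons hz (w.mapLe (SimpleGraph.deleteEdges_le _)))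
      ((SimpleGraph.Walk.cons_isPath_iff _ _).mpr ⟨hw.mapLe _, by simpa using hx⟩)
    simpa using congrArg SimpleGraph.Walk.snd this

theorem isSeparatingForest_deleteEdges (hT : T.IsTree) (h : T.Adj a b) :
    IsSeparatingForest (T.deleteEdges {s(a, b)}) a b where
  isAcyclic := hT.isAcyclic.anti (SimpleGraph.deleteEdges_le _)
  not_reachable := isBridge_of_isTree hT h
  cover z := by
    obtain ⟨p, hp, -⟩ := hT.existsUnique_path a z
    by_cases he : s(a, b) ∈ p.edges
    · right
      cases p with
      | nil => simp at he
      | @cons _ c _ hc q =>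
        -- A simple path from `a` can use an edge at `a` only as its first step.
        have hcb : c = b := by
          rw [SimpleGraph.Walk.cons_isPath_iff] at hp
          rw [SimpleGraph.Walk.edges_cons, List.mem_cons] at he
          rcases he with he | he
          · rcases Sym2.eq_iff.mp he with ⟨-, h⟩ | ⟨h1, h2⟩
            · exact h.symm
            · exact absurd h2.symm h.ne
          · exact absurd (q.fst_mem_support_of_mem_edges he) hp.2
        subst hcb
        exact (reachable_deleteEdges_of_isPath_cons hp).symm
    · left
      refine SimpleGraph.Reachable.symm ⟨p.transfer _ fun e h' => ?_⟩
      rw [SimpleGraph.edgeSet_deleteEdges]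
      exact ⟨p.edges_subset_edgeSet h', fun h'' => he (h'' ▸ h')⟩

/-- There are only two components, so any two unconnected nodes represent both of them. -/
theorem IsSeparatingForest.transfer (h : IsSeparatingForest F a b)
    (hxy : ¬ F.Reachable x y) : IsSeparatingForest F x y := by
  refine ⟨h.isAcyclic, hxy, fun z => ?_⟩
  rcases h.cover x with hx | hx <;> rcases h.cover y with hy | hy
  · exact absurd (hx.trans hy.symm) hxy
  · exact (h.cover z).imp (·.trans hx.symm) (·.trans hy.symm)
  · exact (h.cover z).symm.imp (·.trans hx.symm) (·.trans hy.symm)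
  · exact absurd (hx.trans hy.symm) hxy

open Classical in
/-- If `F` separates `u` from `v`, its contribution to the potential drop from `x` to `y` equals the
signed current through `(x, y)` of the tree obtained from `F` by adding this edge. -/
theorem separatingForest_indicator_comm (F : SimpleGraph V) (u v x y : V) :
    (if IsSeparatingForest F u v then
      (if F.Reachable x u then (1 : ℝ) else 0) - (if F.Reachable y u then 1 else 0) else 0) =
    if IsSeparatingForest F x y then
      (if F.Reachable y v then (1 : ℝ) else 0) - (if F.Reachable y u then 1 else 0) else 0 := by
  by_cases h1 : IsSeparatingForest F u v <;> by_cases h2 : IsSeparatingForest F x y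
  · have hx : F.Reachable x u ↔ ¬ F.Reachable y u :=
      ⟨fun h h' => h2.not_reachable (h.trans h'.symm),
        fun h => ((h2.cover u).resolve_right fun h' => h h'.symm).symm⟩
    have hy : F.Reachable y v ↔ ¬ F.Reachable y u :=
      ⟨fun h h' => h1.not_reachable (h'.symm.trans h), (h1.cover y).resolve_left⟩
    rw [if_pos h1, if_pos h2]
    simp only [hx, hy]
  · have hxy : F.Reachable x y := by
      by_contra h
      exact h2 (h1.transfer h)
    have : F.Reachable x u ↔ F.Reachable y u := ⟨hxy.symm.trans, hxy.trans⟩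
    simp only [h1, h2, this, if_true, if_false, sub_self]
  · have huv : F.Reachable u v := by
      by_contra h
      exact h1 (h2.transfer h)
    have : F.Reachable y v ↔ F.Reachable y u := ⟨(·.trans huv.symm), (·.trans huv)⟩
    simp only [h1, h2, this, if_true, if_false, sub_self]
  · simp only [h1, h2, if_false]

theorem edge_le_of_adj (h : H.Adj a b) : SimpleGraph.edge a b ≤ H := by
  intro c d hcd
  rw [SimpleGraph.edge_adj] at hcd
  rcases hcd with ⟨⟨rfl, rfl⟩ | ⟨rfl, rfl⟩, -⟩
  exacts [h, h.symm]

variable [Fintype V]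

/-! ### Counting forests through trees; the explicit potential -/

theorem mem_spanningTrees : T ∈ spanningTrees H ↔ T ≤ H ∧ T.IsTree := by
  simp [spanningTrees]

theorem mem_spanningTreesWith :
    T ∈ spanningTreesWith H u v ↔ (T ≤ H ∧ T.IsTree) ∧ T.Adj u v := by
  simp [spanningTreesWith, mem_spanningTrees]

open Classical in
/-- Deleting the edge `(a, b)` is a bijection from the spanning trees containing this edge to the
forests that separate `a` from `b`. -/
theorem sum_separatingForest (h : H.Adj a b) (g : SimpleGraph V → ℝ) :
    ∑ F with F ≤ H ∧ IsSeparatingForest F a b, g F =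
      ∑ T ∈ spanningTreesWith H a b, g (T.deleteEdges {s(a, b)}) := by
  symm
  refine Finset.sum_bij' (fun T _ => T.deleteEdges {s(a, b)})
    (fun F _ => F ⊔ SimpleGraph.edge a b) ?_ ?_ ?_ ?_ ?_
  · intro T hT
    obtain ⟨⟨hle, hT⟩, hab⟩ := mem_spanningTreesWith.mp hT
    exact Finset.mem_filter.mpr ⟨Finset.mem_univ _, (SimpleGraph.deleteEdges_le _).trans hle,
      isSeparatingForest_deleteEdges hT hab⟩
  · intro F hF
    obtain ⟨-, hle, hF⟩ := Finset.mem_filter.mp hF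
    exact mem_spanningTreesWith.mpr ⟨⟨sup_le hle (edge_le_of_adj h), hF.isTree_sup_edge⟩,
      Or.inr (by simp [SimpleGraph.edge_adj, h.ne])⟩
  · intro T hT
    exact deleteEdges_sup_edge_of_adj (mem_spanningTreesWith.mp hT).2
  · intro F hF
    exact (Finset.mem_filter.mp hF).2.2.deleteEdges_sup_edge
  · intros
    rfl

-- Taken for `v` and for `u`, the difference of these counts is the divergence at `x` of the unit
-- flow along the tree path from `u` to `v`.
open Classical in
theorem sum_adj_reachable_deleteEdges (hT : T.IsTree) (x v : V) :
    ∑ y with T.Adj x y, (if (T.deleteEdges {s(x, y)}).Reachable y v then (1 : ℝ) else 0) =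
      1 - (Pi.single v 1 : V → ℝ) x := by
  rw [← Finset.sum_filter, Finset.filter_filter]
  by_cases hxv : x = v
  · subst hxv
    rw [Finset.sum_eq_zero]
    · simp
    · intro y hy
      obtain ⟨-, h1, h2⟩ := Finset.mem_filter.mp hy
      exact absurd h2.symm (isBridge_of_isTree hT h1)
  · obtain ⟨y, hy, huniq⟩ := existsUnique_adj_reachable_deleteEdges hT hxv
    rw [show Finset.univ.filter (fun z => T.Adj x z ∧
      (T.deleteEdges {s(x, z)}).Reachable z v) = {y} from ?_]
    · simp [hxv]
    · ext z
      simp only [Finset.mem_filter, Finset.mem_univ, true_and, Finset.mem_singleton]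
      exact ⟨huniq z, fun h => h ▸ hy⟩

open Classical in
/-- The number of spanning forests of `H` that separate `u` from `v` and join `x` to `u`. -/
noncomputable def forestCount (H : SimpleGraph V) (u v x : V) : ℝ :=
  ∑ F with F ≤ H ∧ IsSeparatingForest F u v, if F.Reachable x u then (1 : ℝ) else 0

open Classical in
theorem forestCount_sub (H : SimpleGraph V) (u v : V) (h : H.Adj x y) :
    forestCount H u v x - forestCount H u v y =
      ∑ T ∈ spanningTrees H, if T.Adj x y then
        ((if (T.deleteEdges {s(x, y)}).Reachable y v then (1 : ℝ) else 0) -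
          (if (T.deleteEdges {s(x, y)}).Reachable y u then 1 else 0)) else 0 := by
  rw [← Finset.sum_filter]
  refine Eq.trans ?_ ((sum_separatingForest h fun F =>
    (if F.Reachable y v then (1 : ℝ) else 0) - (if F.Reachable y u then 1 else 0)).trans
      (Finset.sum_congr rfl fun T _ => by congr))
  rw [forestCount, forestCount, ← Finset.sum_sub_distrib]
  -- Both sums now range over all subforests of `H`, so the identity can be checked for each `F`
  -- separately.
  rw [← Finset.filter_filter, ← Finset.filter_filter, Finset.sum_filter,
    Finset.sum_filter (p := fun F => IsSeparatingForest F x y)]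
  exact Finset.sum_congr rfl fun F _ => by
    convert separatingForest_indicator_comm F u v x y

open Classical in
theorem lapMatrix_mulVec_forestCount (H : SimpleGraph V) (u v : V) :
    (H.lapMatrix ℝ).mulVec (forestCount H u v) =
      ((spanningTrees H).card : ℝ) • (Pi.single u 1 - Pi.single v 1) := by
  funext x
  have h1 : (H.lapMatrix ℝ).mulVec (forestCount H u v) x =
      ∑ y with H.Adj x y, (forestCount H u v x - forestCount H u v y) := by
    rw [SimpleGraph.lapMatrix_mulVec_apply, Finset.sum_sub_distrib, Finset.sum_const,
      nsmul_eq_mul, ← SimpleGraph.neighborFinset_eq_filter, SimpleGraph.card_neighborFinset_eq_degree]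
  rw [h1, Finset.sum_congr rfl fun y hy => forestCount_sub H u v (Finset.mem_filter.mp hy).2,
    Finset.sum_comm]
  have h2 : ∀ T ∈ spanningTrees H, (∑ y with H.Adj x y, if T.Adj x y then
        ((if (T.deleteEdges {s(x, y)}).Reachable y v then (1 : ℝ) else 0) -
          (if (T.deleteEdges {s(x, y)}).Reachable y u then 1 else 0)) else 0) =
      (Pi.single u 1 - Pi.single v 1 : V → ℝ) x := by
    intro T hT
    obtain ⟨hle, hT⟩ := mem_spanningTrees.mp hT
    rw [← Finset.sum_filter, Finset.filter_filter,
      Finset.filter_congr (q := fun y => T.Adj x y) fun y _ => ⟨And.right, fun h => ⟨hle h, h⟩⟩,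
      Finset.sum_sub_distrib, sum_adj_reachable_deleteEdges hT,
      sum_adj_reachable_deleteEdges hT, Pi.sub_apply]
    ring
  rw [Finset.sum_congr rfl h2, Finset.sum_const, nsmul_eq_mul]
  rfl

theorem spanningTrees_nonempty (hH : H.Connected) : (spanningTrees H).Nonempty := by
  obtain ⟨T, hle, hT⟩ := hH.exists_isTree_le
  exact ⟨T, mem_spanningTrees.mpr ⟨hle, hT⟩⟩

theorem spanningTreesWith_nonempty (hH : H.Connected) (h : H.Adj u v) :
    (spanningTreesWith H u v).Nonempty := by
  -- The single edge is acyclic, hence extends to a spanning tree.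
  obtain ⟨T, hle, hTH, hT⟩ := hH.exists_isTree_le_of_le_of_isAcyclic (edge_le_of_adj h) (by
    simpa using SimpleGraph.isAcyclic_bot.sup_edge_of_not_reachable
      (SimpleGraph.reachable_bot.not.mpr h.ne))
  exact ⟨T, mem_spanningTreesWith.mpr ⟨⟨hTH, hT⟩, hle (by simp [SimpleGraph.edge_adj, h.ne])⟩⟩

/-- **Kirchhoff's theorem**: the effective resistance between the end nodes of an edge is the
proportion of spanning trees that contain this edge. -/
theorem effectiveResistance_eq_card_div_card (hH : H.Connected) (h : H.Adj u v) :
    effectiveResistance H u v =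
      ((spanningTreesWith H u v).card : ℝ) / ((spanningTrees H).card : ℝ) := by
  classical
  have hN : ((spanningTrees H).card : ℝ) ≠ 0 := by
    exact_mod_cast (spanningTrees_nonempty hH).card_ne_zero
  have hφ : IsUnitCurrentPotential H u v
      (((spanningTrees H).card : ℝ)⁻¹ • forestCount H u v) := by
    unfold IsUnitCurrentPotential
    rw [Matrix.mulVec_smul, lapMatrix_mulVec_forestCount, smul_smul, inv_mul_cancel₀ hN, one_smul]
  -- At `u` every separating forest counts, and adding the edge makes each one a tree.
  have hu : forestCount H u v u = (spanningTreesWith H u v).card := by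
    simp only [forestCount, SimpleGraph.Reachable.refl, if_true]
    rw [sum_separatingForest h fun _ => 1]
    simp
  have hv : forestCount H u v v = 0 := by
    refine Finset.sum_eq_zero fun F hF => if_neg fun hr => ?_
    exact (Finset.mem_filter.mp hF).2.2.not_reachable hr.symm
  rw [effectiveResistance_eq hH hφ]
  simp only [Pi.smul_apply, smul_eq_mul, hu, hv]
  ring

/-! ### Splitting the trees by the inserted edge -/

open Classical in
theorem filter_not_adj_spanningTrees_insertEdge {G : SimpleGraph V} (hnew : ¬ G.Adj u v) :
    {T ∈ spanningTrees (insertEdge G u v) | ¬ T.Adj u v} = spanningTrees G := by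
  ext T
  rw [Finset.mem_filter, mem_spanningTrees, mem_spanningTrees]
  constructor
  · rintro ⟨⟨hle, hT⟩, hadj⟩
    refine ⟨fun c d hcd => (hle hcd).resolve_right fun he => hadj ?_, hT⟩
    rw [SimpleGraph.edge_adj] at he
    rcases he with ⟨⟨rfl, rfl⟩ | ⟨rfl, rfl⟩, -⟩
    exacts [hcd, hcd.symm]
  · rintro ⟨hle, hT⟩
    exact ⟨⟨hle.trans le_sup_left, hT⟩, fun h => hnew (hle h)⟩

theorem sum_spanningTrees_insertEdge {G : SimpleGraph V} (hnew : ¬ G.Adj u v)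
    (f : SimpleGraph V → ℝ) :
    ∑ T ∈ spanningTrees (insertEdge G u v), f T =
      ∑ T ∈ spanningTrees G, f T + ∑ T ∈ spanningTreesWith (insertEdge G u v) u v, f T := by
  classical
  rw [← filter_not_adj_spanningTrees_insertEdge hnew, add_comm]
  exact (Finset.sum_filter_add_sum_filter_not _ (fun T => T.Adj u v) f).symm

theorem uniformExpectation_insertEdge {G : SimpleGraph V} (hG : G.Connected) (huv : u ≠ v)
    (hnew : ¬ G.Adj u v) (f : SimpleGraph V → ℝ) :
    uniformExpectation (spanningTrees (insertEdge G u v)) f =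
      (1 - effectiveResistance (insertEdge G u v) u v) * uniformExpectation (spanningTrees G) f +
        effectiveResistance (insertEdge G u v) u v *
          uniformExpectation (spanningTreesWith (insertEdge G u v) u v) f := by
  have hH : (insertEdge G u v).Connected := hG.mono le_sup_left
  have hadj : (insertEdge G u v).Adj u v := Or.inr (by simp [SimpleGraph.edge_adj, huv])
  have hcard : ((spanningTrees (insertEdge G u v)).card : ℝ) =
      (spanningTrees G).card + (spanningTreesWith (insertEdge G u v) u v).card := by
    simpa using sum_spanningTrees_insertEdge hnew fun _ => 1
  have hA : (0 : ℝ) < (spanningTrees G).card := by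
    exact_mod_cast (spanningTrees_nonempty hG).card_pos
  have hB : (0 : ℝ) < (spanningTreesWith (insertEdge G u v) u v).card := by
    exact_mod_cast (spanningTreesWith_nonempty hH hadj).card_pos
  rw [effectiveResistance_eq_card_div_card hH hadj]
  simp only [uniformExpectation, ← Finset.mul_sum]
  rw [sum_spanningTrees_insertEdge hnew f, hcard]
  field_simp
  ring

end BSM

theorem mainTheorem6 {V : Type*} [Fintype V] (G : SimpleGraph V) (hG : G.Connected)
    (u v : V) (huv : u ≠ v) (hnew : ¬ G.Adj u v) :
    (BSM.spanningTrees (BSM.insertEdge G u v)).Nonempty ∧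
    (BSM.spanningTrees G).Nonempty ∧
    (BSM.spanningTreesWith (BSM.insertEdge G u v) u v).Nonempty ∧
    (∀ f : SimpleGraph V → ℝ,
      BSM.uniformExpectation (BSM.spanningTrees (BSM.insertEdge G u v)) f =
        (1 - BSM.effectiveResistance (BSM.insertEdge G u v) u v) *
            BSM.uniformExpectation (BSM.spanningTrees G) f +
          BSM.effectiveResistance (BSM.insertEdge G u v) u v *
            BSM.uniformExpectation (BSM.spanningTreesWith (BSM.insertEdge G u v) u v) f) ∧
    (∀ (r : V) (P : ∀ w, (BSM.insertEdge G u v).Path w r),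
      BSM.uniformExpectation (BSM.spanningTrees (BSM.insertEdge G u v))
          (BSM.treeValue (BSM.insertEdge G u v) r P) =
        (1 - BSM.effectiveResistance (BSM.insertEdge G u v) u v) *
            BSM.uniformExpectation (BSM.spanningTrees G)
              (BSM.treeValue (BSM.insertEdge G u v) r P) +
          BSM.effectiveResistance (BSM.insertEdge G u v) u v *
            BSM.uniformExpectation (BSM.spanningTreesWith (BSM.insertEdge G u v) u v)
              (BSM.treeValue (BSM.insertEdge G u v) r P)) := by
  have hH : (BSM.insertEdge G u v).Connected := hG.mono le_sup_left
  have hadj : (BSM.insertEdge G u v).Adj u v := Or.inr (by simp [SimpleGraph.edge_adj, huv])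
  exact ⟨BSM.spanningTrees_nonempty hH, BSM.spanningTrees_nonempty hG,
    BSM.spanningTreesWith_nonempty hH hadj, BSM.uniformExpectation_insertEdge hG huv hnew,
    fun r P => BSM.uniformExpectation_insertEdge hG huv hnew _⟩
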